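/- Let $(\Omega,\mathcal F,P)$ be a probability space, $X\in L^2(\Omega,\mathcal F,P)$ a real random variable with law $\mu_X$, $\alpha\in(0,1)$ and $\delta_2>0$. For $x\in\mathbb R$ write $x^+=\max\{x,0\}$, $x^-=\max\{-x,0\}$ and $h(x)=\alpha (x^+)^2+(1-\alpha)(x^-)^2$. Let $\mathcal M(\mathbb R)$ be the set of Borel probability measures on $\mathbb R$ and, for $\mu\in\mathcal M(\mathbb R)$, let $$d_c(\mu_X,\mu)=\inf_{\pi}\int_{\mathbb R\times\mathbb R}|x-y|^2\,\pi(dx,dy)\in[0,+\infty],$$ where the infimum is over the Borel probability measures $\pi$ on $\mathbb R\times\mathbb R$ with first marginal $\mu_X$ and second marginal $\mu$. Let $\varphi_2:[0,+\infty]\to[0,+\infty]$ be given by $\varphi_2(x)=0$ for $x\le\delta_2$ and $\varphi_2(x)=+\infty$ for $x>\delta_2$. For $m\in\mathbb R$ put $$\mathcal E_{\varphi_2}(h,X,m)=\sup_{\mu\in\mathcal M(\mathbb R)}\left(\int_{\mathbb R}h(x-m)\,\mu(dx)-\varphi_2\big(d_c(\mu_X,\mu)\big)\right),$$ with the convention $\infty-\infty=-\infty$,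 so that the supremum is effectively over the $\mu$ with $d_c(\mu_X,\mu)\le\delta_2$. The robust expectile of $X$ with penalization function $\varphi_2$ is $$e_{\alpha,\varphi_2}(X):=\operatorname*{argmin}_{m\in\mathbb R}\ \mathcal E_{\varphi_2}(h,X,m),$$ the set of global minimizers. Then, as an equality of sets of global minimizers, $$e_{\alpha,\varphi_2}(X)=\operatorname*{argmin}_{m\in\mathbb R}\left\{\inf_{\lambda>\max\{\alpha,1-\alpha\}}g_2(X,m,\lambda,\alpha)\right\},$$ where $$g_2(X,m,\lambda,\alpha)=\frac{\alpha\lambda}{\lambda-\alpha}E_P\left[((X-m)^{+})^2\right]+\frac{(1-\alpha)\lambda}{\lambda-(1-\alpha)}E_P\left[((X-m)^{-})^2\right]+\delta_2\lambda .$$ -/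

import Mathlib

open MeasureTheory
open scoped ENNReal

noncomputable section

namespace RobustExpectile

/-- The set of global minimizers of `f`. -/
def argmin {β : Type*} [Preorder β] (f : ℝ → β) : Set ℝ :=
  {m | ∀ m', f m ≤ f m'}

/-- The integral of a real function `f`, with values in the extended reals, as the integral of the
positive part minus that of the negative part. It is the usual one for every measurable `f` that is
bounded from below and every probability measure `μ` (the value `+∞` being possible). -/
def extIntegral (f : ℝ → ℝ) (μ : Measure ℝ) : EReal :=
  ((∫⁻ x, ENNReal.ofReal (f x) ∂μ : ℝ≥0∞) : EReal)
    - ((∫⁻ x, ENNReal.ofReal (-f x) ∂μ : ℝ≥0∞) : EReal)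

/-- The optimal transport cost `d_c(μ, ν)` for a nonnegative cost function `c`: the infimum of
`∫ c dπ` over all couplings `π` of `μ` and `ν`. No root is taken. -/
def transportCost (c : ℝ → ℝ → ℝ) (μ ν : ProbabilityMeasure ℝ) : ℝ≥0∞ :=
  ⨅ π : ProbabilityMeasure (ℝ × ℝ),
    ⨅ _ : (π : Measure (ℝ × ℝ)).fst = μ ∧ (π : Measure (ℝ × ℝ)).snd = ν,
      ∫⁻ z, ENNReal.ofReal (c z.1 z.2) ∂(π : Measure (ℝ × ℝ))

/-- The quadratic cost `c(x, y) = |x - y|²`. -/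
def quadCost (x y : ℝ) : ℝ := |x - y| ^ 2

/-- The nonlinear functional
`sup_μ (∫ l(x - m) μ(dx) - φ(d_c(ν, μ)))`, over all probability measures `μ` on the line, around the
baseline law `ν`. In `EReal` one has `⊤ - ⊤ = ⊥`, so a measure with infinite penalty never
contributes to the supremum. -/
def penalizedSup (c : ℝ → ℝ → ℝ) (φ : ℝ≥0∞ → ℝ≥0∞) (l : ℝ → ℝ)
    (ν : ProbabilityMeasure ℝ) (m : ℝ) : EReal :=
  ⨆ μ : ProbabilityMeasure ℝ,
    (extIntegral (fun x => l (x - m)) (μ : Measure ℝ) - ((φ (transportCost c ν μ) : ℝ≥0∞) : EReal))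

/-- The asymmetric quadratic loss `h(x) = α (x⁺)² + (1 - α) (x⁻)²`. -/
def expectileLoss (α x : ℝ) : ℝ := α * (x⁺) ^ 2 + (1 - α) * (x⁻) ^ 2

/-- The robust expectiles with penalization function `φ` of a random variable with law `ν`, as a
set of minimizers. -/
def robustExpectile (α : ℝ) (φ : ℝ≥0∞ → ℝ≥0∞) (ν : ProbabilityMeasure ℝ) : Set ℝ :=
  argmin (fun m => penalizedSup quadCost φ (expectileLoss α) ν m)

/-- The penalization function `∞ · I_{(δ, +∞)}` on `[0, +∞]`; its value at `+∞` is `+∞`. -/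
def ballPenalty (δ : ℝ) (x : ℝ≥0∞) : ℝ≥0∞ := if ENNReal.ofReal δ < x then ∞ else 0

/-- The dual objective `g₂(X, m, lam, α)`, with the radius `δ`. -/
def dualObjective {Ω : Type*} [MeasurableSpace Ω] (P : Measure Ω) (X : Ω → ℝ)
    (α δ m lam : ℝ) : ℝ :=
  α * lam / (lam - α) * (∫ ω, ((X ω - m)⁺) ^ 2 ∂P)
    + (1 - α) * lam / (lam - (1 - α)) * (∫ ω, ((X ω - m)⁻) ^ 2 ∂P)
    + δ * lam

end RobustExpectile

end

open MeasureTheory Filter Topology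
open scoped ENNReal

noncomputable section

namespace RobustExpectile

/-! The two objectives agree for each fixed `m`, by Lagrangian duality with multiplier `lam` for the
transport budget. Integrating `h(y) ≤ envelope(x) + lam (x - y)²` against a coupling gives the upper
bound (`penalizedSup_le_dualObjective`). Conversely, the envelope is attained by an explicit map of
cost `C(lam)`, continuous in `lam` and tending to `0` at infinity. If `C(lam) = δ` for some `lam`,
this map is optimal. Otherwise `C < δ` on the whole range (as when `X = m` a.s.), and the unspent
budget moves a tiny mass very far, at a gain of `M = max α (1 - α)` per unit of cost
(`sub_slack_le_penalizedSup`). The remaining gap vanishes as `lam ↓ M`. -/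

lemma expectileLoss_of_nonneg (α : ℝ) {x : ℝ} (hx : 0 ≤ x) : expectileLoss α x = α * x ^ 2 := by
  simp [expectileLoss, posPart_of_nonneg hx, negPart_of_nonneg hx]

lemma expectileLoss_of_nonpos (α : ℝ) {x : ℝ} (hx : x ≤ 0) :
    expectileLoss α x = (1 - α) * x ^ 2 := by
  simp [expectileLoss, posPart_of_nonpos hx, negPart_of_nonpos hx]

lemma expectileLoss_nonneg {α : ℝ} (hα0 : 0 < α) (hα1 : α < 1) (x : ℝ) :
    0 ≤ expectileLoss α x := by
  have : 0 < 1 - α := by linarith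
  unfold expectileLoss
  positivity

@[fun_prop]
lemma continuous_real_posPart : Continuous (fun x : ℝ => x⁺) := by
  simp only [posPart_def]; fun_prop

@[fun_prop]
lemma continuous_real_negPart : Continuous (fun x : ℝ => x⁻) := by
  simp only [negPart_def]; fun_prop

@[fun_prop]
lemma continuous_expectileLoss (α : ℝ) : Continuous (expectileLoss α) := by
  unfold expectileLoss
  exact ((continuous_real_posPart.pow 2).const_mul _).add
    ((continuous_real_negPart.pow 2).const_mul _)

/-- The Moreau-type envelope `sup_y (h(y) - lam (x - y)²)` of the expectile loss. -/
def lossEnvelope (α lam x : ℝ) : ℝ :=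
  α * lam / (lam - α) * (x⁺) ^ 2 + (1 - α) * lam / (lam - (1 - α)) * (x⁻) ^ 2

/-- The difference of the two sides is a perfect square, zero at `y = lam x / (lam - a)`; this is
the slope used in `optimalMap`. -/
lemma mul_sq_le_envelope {a lam : ℝ} (h : a < lam) (x y : ℝ) :
    a * y ^ 2 ≤ a * lam / (lam - a) * x ^ 2 + lam * (x - y) ^ 2 := by
  have h' : 0 < lam - a := by linarith
  have : a * lam / (lam - a) * x ^ 2 + lam * (x - y) ^ 2 - a * y ^ 2
      = ((lam - a) * y - lam * x) ^ 2 / (lam - a) := by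
    field_simp; ring
  have : 0 ≤ ((lam - a) * y - lam * x) ^ 2 / (lam - a) := by positivity
  linarith

/-- For opposite signs `(x - y)² ≥ y²`, so the transport cost alone pays for crossing the kink of
the loss. -/
lemma mul_sq_le_of_opposite {b lam x y : ℝ} (h : b < lam) (hlam : 0 < lam) (hxy : x * y ≤ 0) :
    b * y ^ 2 ≤ lam * (x - y) ^ 2 := by
  nlinarith [mul_nonneg (sub_nonneg.2 h.le) (sq_nonneg y), mul_nonneg hlam.le (sq_nonneg x),
    mul_nonneg hlam.le (neg_nonneg.2 hxy)]

lemma expectileLoss_le_lossEnvelope {α lam : ℝ} (hα0 : 0 < α) (hα1 : α < 1) (ha : α < lam)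
    (hb : 1 - α < lam) (x y : ℝ) :
    expectileLoss α y ≤ lossEnvelope α lam x + lam * (x - y) ^ 2 := by
  have hlam : 0 < lam := hα0.trans ha
  have hβ : 0 < 1 - α := by linarith
  have h1 : 0 < lam - α := by linarith
  have h2 : 0 < lam - (1 - α) := by linarith
  have hA : 0 ≤ α * lam / (lam - α) * x ^ 2 := by positivity
  have hB : 0 ≤ (1 - α) * lam / (lam - (1 - α)) * x ^ 2 := by positivity
  rcases le_total 0 x with hx | hx <;> rcases le_total 0 y with hy | hy <;>
    simp only [lossEnvelope, expectileLoss_of_nonneg, expectileLoss_of_nonpos, hx, hy,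
      posPart_of_nonneg, negPart_of_nonneg, posPart_of_nonpos, negPart_of_nonpos, neg_sq]
  · linarith [mul_sq_le_envelope ha x y]
  · linarith [mul_sq_le_of_opposite hb hlam (mul_nonpos_of_nonneg_of_nonpos hx hy)]
  · linarith [mul_sq_le_of_opposite ha hlam (mul_nonpos_of_nonpos_of_nonneg hx hy)]
  · linarith [mul_sq_le_envelope hb x y]

lemma extIntegral_of_nonneg {f : ℝ → ℝ} (hf : ∀ x, 0 ≤ f x) (μ : Measure ℝ) :
    extIntegral f μ = ((∫⁻ x, ENNReal.ofReal (f x) ∂μ : ℝ≥0∞) : EReal) := by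
  have : ∀ x, ENNReal.ofReal (-f x) = 0 := fun x => by simp [hf x]
  simp [extIntegral, this]

lemma integrable_posPart_sq {ν : Measure ℝ} [IsProbabilityMeasure ν] (h2 : MemLp id 2 ν) (m : ℝ) :
    Integrable (fun x : ℝ => ((x - m)⁺) ^ 2) ν := by
  refine (h2.sub (memLp_const m)).integrable_sq.mono
    (Continuous.aestronglyMeasurable (by fun_prop)) (ae_of_all _ fun x => ?_)
  rcases le_total 0 (x - m) with h | h <;>
    simp [h, posPart_of_nonneg, posPart_of_nonpos]
  exact sq_nonneg _

lemma integrable_negPart_sq {ν : Measure ℝ} [IsProbabilityMeasure ν] (h2 : MemLp id 2 ν) (m : ℝ) :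
    Integrable (fun x : ℝ => ((x - m)⁻) ^ 2) ν := by
  refine (h2.sub (memLp_const m)).integrable_sq.mono
    (Continuous.aestronglyMeasurable (by fun_prop)) (ae_of_all _ fun x => ?_)
  rcases le_total 0 (x - m) with h | h <;>
    simp [h, negPart_of_nonneg, negPart_of_nonpos]
  exact (by ring : (m - x) ^ 2 = (x - m) ^ 2).le

section Combination

variable {ν : Measure ℝ} [IsProbabilityMeasure ν]

lemma integrable_posPart_negPart_comb (h2 : MemLp id 2 ν) (m p q : ℝ) :
    Integrable (fun x : ℝ => p * ((x - m)⁺) ^ 2 + q * ((x - m)⁻) ^ 2) ν :=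
  ((integrable_posPart_sq h2 m).const_mul p).add ((integrable_negPart_sq h2 m).const_mul q)

lemma integral_posPart_negPart_comb (h2 : MemLp id 2 ν) (m p q : ℝ) :
    ∫ x, (p * ((x - m)⁺) ^ 2 + q * ((x - m)⁻) ^ 2) ∂ν
      = p * (∫ x, ((x - m)⁺) ^ 2 ∂ν) + q * (∫ x, ((x - m)⁻) ^ 2 ∂ν) := by
  rw [integral_add ((integrable_posPart_sq h2 m).const_mul p)
    ((integrable_negPart_sq h2 m).const_mul q), integral_const_mul, integral_const_mul]

end Combination

lemma dualObjective_eq_integral {ν : Measure ℝ} [IsProbabilityMeasure ν] (h2 : MemLp id 2 ν)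
    (α δ m lam : ℝ) :
    dualObjective ν id α δ m lam = ∫ x, lossEnvelope α lam (x - m) ∂ν + δ * lam := by
  simp only [lossEnvelope, dualObjective, integral_posPart_negPart_comb h2, id]

/-! ### Weak duality -/

/-- Weak duality, for a fixed measure of finite transport cost. -/
lemma lintegral_loss_le_dualObjective {ν : ProbabilityMeasure ℝ} (h2 : MemLp id 2 (ν : Measure ℝ))
    {α δ lam : ℝ} (hα0 : 0 < α) (hα1 : α < 1) (hδ : 0 < δ) (ha : α < lam) (hb : 1 - α < lam)
    (m : ℝ) (μ : ProbabilityMeasure ℝ) (hμ : transportCost quadCost ν μ ≤ ENNReal.ofReal δ) :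
    ∫⁻ y, ENNReal.ofReal (expectileLoss α (y - m)) ∂(μ : Measure ℝ)
      ≤ ENNReal.ofReal (dualObjective (ν : Measure ℝ) id α δ m lam) := by
  have hlam : 0 < lam := hα0.trans ha
  have hβ : 0 < 1 - α := by linarith
  have h1 : 0 < lam - α := by linarith
  have h2' : 0 < lam - (1 - α) := by linarith
  have hK : ∀ x, 0 ≤ lossEnvelope α lam (x - m) := fun x => by unfold lossEnvelope; positivity
  have hKm : Measurable fun x => ENNReal.ofReal (lossEnvelope α lam (x - m)) := by
    apply Measurable.ennreal_ofReal
    apply Continuous.measurable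
    unfold lossEnvelope
    fun_prop
  set L := ∫⁻ y, ENNReal.ofReal (expectileLoss α (y - m)) ∂(μ : Measure ℝ) with hL
  set K := ∫⁻ x, ENNReal.ofReal (lossEnvelope α lam (x - m)) ∂(ν : Measure ℝ) with hKdef
  have hcoupling : ∀ π : ProbabilityMeasure (ℝ × ℝ),
      ((π : Measure (ℝ × ℝ)).fst = ν ∧ (π : Measure (ℝ × ℝ)).snd = μ) →
      L ≤ K + ENNReal.ofReal lam
        * ∫⁻ z, ENNReal.ofReal (quadCost z.1 z.2) ∂(π : Measure (ℝ × ℝ)) := by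
    rintro π ⟨hfst, hsnd⟩
    have hq : Measurable fun z : ℝ × ℝ => ENNReal.ofReal (quadCost z.1 z.2) := by
      apply Measurable.ennreal_ofReal
      unfold quadCost
      fun_prop
    rw [hL, hKdef, ← hfst, ← hsnd, Measure.fst, Measure.snd, lintegral_map (by fun_prop)
      measurable_snd, lintegral_map hKm measurable_fst, ← lintegral_const_mul _ hq,
      ← lintegral_add_right _ (hq.const_mul _)]
    refine lintegral_mono fun z => ?_
    rw [← ENNReal.ofReal_mul hlam.le, ← ENNReal.ofReal_add (hK _)
      (mul_nonneg hlam.le (by unfold quadCost; positivity))]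
    refine ENNReal.ofReal_le_ofReal ?_
    have := expectileLoss_le_lossEnvelope hα0 hα1 ha hb (z.1 - m) (z.2 - m)
    simpa [quadCost] using this
  -- The left side does not depend on the coupling, so the infimum can be taken without an optimal
  -- coupling.
  have hinf : (L - K) / ENNReal.ofReal lam ≤ transportCost quadCost ν μ := by
    refine le_iInf fun π => le_iInf fun hπ => ?_
    refine ENNReal.div_le_of_le_mul' ?_
    exact tsub_le_iff_left.2 (hcoupling π hπ)
  have hlam0 : ENNReal.ofReal lam ≠ 0 := by simpa using hlam
  have hfin : L ≤ K + ENNReal.ofReal lam * ENNReal.ofReal δ :=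
    tsub_le_iff_left.1
      ((ENNReal.div_le_iff_le_mul (Or.inl hlam0) (Or.inl ENNReal.ofReal_ne_top)).1
        (hinf.trans hμ) |>.trans_eq (mul_comm _ _))
  refine hfin.trans_eq ?_
  rw [dualObjective_eq_integral h2, ENNReal.ofReal_add (integral_nonneg hK) (by positivity),
    ofReal_integral_eq_lintegral_ofReal (f := fun x => lossEnvelope α lam (x - m))
      (integrable_posPart_negPart_comb h2 m _ _) (ae_of_all _ hK), ← ENNReal.ofReal_mul hlam.le, mul_comm lam δ]

theorem penalizedSup_le_dualObjective {ν : ProbabilityMeasure ℝ}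
    (h2 : MemLp id 2 (ν : Measure ℝ)) {α δ lam : ℝ} (hα0 : 0 < α) (hα1 : α < 1) (hδ : 0 < δ)
    (ha : α < lam) (hb : 1 - α < lam) (m : ℝ) :
    penalizedSup quadCost (ballPenalty δ) (expectileLoss α) ν m
      ≤ ((dualObjective (ν : Measure ℝ) id α δ m lam : ℝ) : EReal) := by
  have hlam : 0 < lam := hα0.trans ha
  have hβ : 0 < 1 - α := by linarith
  have h1 : 0 < lam - α := by linarith
  have h2' : 0 < lam - (1 - α) := by linarith
  have hG : 0 ≤ dualObjective (ν : Measure ℝ) id α δ m lam := by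
    unfold dualObjective; positivity
  refine iSup_le fun μ => ?_
  rw [extIntegral_of_nonneg fun x => expectileLoss_nonneg hα0 hα1 _]
  by_cases hμ : ENNReal.ofReal δ < transportCost quadCost ν μ
  · simp [ballPenalty, hμ]
  · have := lintegral_loss_le_dualObjective h2 hα0 hα1 hδ ha hb m μ (not_lt.1 hμ)
    have := EReal.coe_ennreal_le_coe_ennreal_iff.2 this
    rw [EReal.coe_ennreal_ofReal, max_eq_left hG] at this
    simpa [ballPenalty, hμ] using this

/-! ### Lower bounds from explicit couplings -/

/-- Every coupling within the ball gives a lower bound for the robust functional. -/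
lemma lintegral_le_penalizedSup {ν : ProbabilityMeasure ℝ} {α δ : ℝ} (hα0 : 0 < α) (hα1 : α < 1)
    (m : ℝ) (κ : Measure (ℝ × ℝ)) [IsProbabilityMeasure κ] (hκ : κ.fst = ν)
    (hcost : ∫⁻ z, ENNReal.ofReal (quadCost z.1 z.2) ∂κ ≤ ENNReal.ofReal δ) :
    ((∫⁻ z, ENNReal.ofReal (expectileLoss α (z.2 - m)) ∂κ : ℝ≥0∞) : EReal)
      ≤ penalizedSup quadCost (ballPenalty δ) (expectileLoss α) ν m := by
  let μ : ProbabilityMeasure ℝ := ⟨κ.snd, inferInstance⟩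
  let π : ProbabilityMeasure (ℝ × ℝ) := ⟨κ, inferInstance⟩
  have hd : transportCost quadCost ν μ ≤ ENNReal.ofReal δ :=
    (iInf₂_le π ⟨hκ, rfl⟩).trans hcost
  refine le_trans (le_of_eq ?_) (le_iSup _ μ)
  have hsnd : ∫⁻ x, ENNReal.ofReal (expectileLoss α (x - m)) ∂(μ : Measure ℝ)
      = ∫⁻ z, ENNReal.ofReal (expectileLoss α (z.2 - m)) ∂κ := by
    change ∫⁻ x, ENNReal.ofReal (expectileLoss α (x - m)) ∂κ.snd = _
    rw [Measure.snd, lintegral_map (by fun_prop) measurable_snd]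
  rw [extIntegral_of_nonneg fun x => expectileLoss_nonneg hα0 hα1 _, hsnd]
  simp [ballPenalty, not_lt.2 hd]

/-- The lower bound from the coupling that moves `x` to `T x` with probability `1 - ε` and to `S x`
with probability `ε`. -/
lemma mixture_le_penalizedSup {ν : ProbabilityMeasure ℝ} {α δ : ℝ} (hα0 : 0 < α) (hα1 : α < 1)
    (m : ℝ) {T S : ℝ → ℝ} (hT : Measurable T) (hS : Measurable S) {ε : ℝ} (hε0 : 0 ≤ ε)
    (hε1 : ε ≤ 1) (hTq : Integrable (fun x => quadCost x (T x)) (ν : Measure ℝ))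
    (hSq : Integrable (fun x => quadCost x (S x)) (ν : Measure ℝ))
    (hTl : Integrable (fun x => expectileLoss α (T x - m)) (ν : Measure ℝ))
    (hSl : Integrable (fun x => expectileLoss α (S x - m)) (ν : Measure ℝ))
    (hcost : (1 - ε) * ∫ x, quadCost x (T x) ∂(ν : Measure ℝ)
      + ε * ∫ x, quadCost x (S x) ∂(ν : Measure ℝ) ≤ δ) :
    (((1 - ε) * ∫ x, expectileLoss α (T x - m) ∂(ν : Measure ℝ)
      + ε * ∫ x, expectileLoss α (S x - m) ∂(ν : Measure ℝ) : ℝ) : EReal)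
      ≤ penalizedSup quadCost (ballPenalty δ) (expectileLoss α) ν m := by
  have hε1' : 0 ≤ 1 - ε := by linarith
  have hTm : Measurable fun x => (x, T x) := measurable_id.prodMk hT
  have hSm : Measurable fun x => (x, S x) := measurable_id.prodMk hS
  -- The destination is randomized because a map could not split an atom of `ν`.
  set κ : Measure (ℝ × ℝ) := ENNReal.ofReal (1 - ε) • (ν : Measure ℝ).map (fun x => (x, T x))
    + ENNReal.ofReal ε • (ν : Measure ℝ).map (fun x => (x, S x)) with hκdef
  have hκ : κ.fst = ν := by
    rw [Measure.fst, hκdef, Measure.map_add _ _ measurable_fst, Measure.map_smul, Measure.map_smul,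
      Measure.map_map measurable_fst hTm, Measure.map_map measurable_fst hSm]
    change ENNReal.ofReal (1 - ε) • (ν : Measure ℝ).map id
      + ENNReal.ofReal ε • (ν : Measure ℝ).map id = ν
    rw [Measure.map_id, ← add_smul, ← ENNReal.ofReal_add hε1' hε0]
    simp
  have hprob : IsProbabilityMeasure κ := by
    refine ⟨?_⟩
    rw [← Measure.fst_univ, hκ, measure_univ]
  have key : ∀ f : ℝ × ℝ → ℝ, Measurable f → (∀ z, 0 ≤ f z) →
      Integrable (fun x => f (x, T x)) (ν : Measure ℝ) →
      Integrable (fun x => f (x, S x)) (ν : Measure ℝ) →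
      ∫⁻ z, ENNReal.ofReal (f z) ∂κ = ENNReal.ofReal
        ((1 - ε) * ∫ x, f (x, T x) ∂(ν : Measure ℝ) + ε * ∫ x, f (x, S x) ∂(ν : Measure ℝ)) := by
    intro f hf hf0 hfT hfS
    have hT0 : 0 ≤ ∫ x, f (x, T x) ∂(ν : Measure ℝ) := integral_nonneg fun x => hf0 _
    have hS0 : 0 ≤ ∫ x, f (x, S x) ∂(ν : Measure ℝ) := integral_nonneg fun x => hf0 _
    rw [hκdef, lintegral_add_measure, lintegral_smul_measure, lintegral_smul_measure,
      lintegral_map hf.ennreal_ofReal hTm, lintegral_map hf.ennreal_ofReal hSm,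
      ← ofReal_integral_eq_lintegral_ofReal hfT (ae_of_all _ fun x => hf0 _),
      ← ofReal_integral_eq_lintegral_ofReal hfS (ae_of_all _ fun x => hf0 _),
      ENNReal.ofReal_add (by positivity) (by positivity), ENNReal.ofReal_mul hε1',
      ENNReal.ofReal_mul hε0]
    rfl
  have hc := key (fun z => quadCost z.1 z.2) (by unfold quadCost; fun_prop)
    (fun z => by unfold quadCost; positivity) hTq hSq
  have hl := key (fun z => expectileLoss α (z.2 - m))
    ((continuous_expectileLoss α).comp
      (by fun_prop : Continuous fun z : ℝ × ℝ => z.2 - m)).measurable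
    (fun z => expectileLoss_nonneg hα0 hα1 _) hTl hSl
  have := lintegral_le_penalizedSup (δ := δ) hα0 hα1 m κ hκ
    (hc.trans_le (ENNReal.ofReal_le_ofReal hcost))
  rw [hl, EReal.coe_ennreal_ofReal] at this
  exact le_trans (EReal.coe_le_coe_iff.2 (le_max_left _ _)) this

/-- The transport map that attains the envelope of the loss at the multiplier `lam`. -/
def optimalMap (α m lam x : ℝ) : ℝ :=
  m + lam / (lam - α) * (x - m)⁺ - lam / (lam - (1 - α)) * (x - m)⁻

/-- The cost of `optimalMap`. -/
def optimalCost (ν : Measure ℝ) (α m lam : ℝ) : ℝ :=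
  (α / (lam - α)) ^ 2 * (∫ x, ((x - m)⁺) ^ 2 ∂ν)
    + ((1 - α) / (lam - (1 - α))) ^ 2 * (∫ x, ((x - m)⁻) ^ 2 ∂ν)

lemma measurable_optimalMap (α m lam : ℝ) : Measurable (optimalMap α m lam) := by
  apply Continuous.measurable
  unfold optimalMap
  fun_prop

lemma quadCost_optimalMap {α lam : ℝ} (ha : α < lam) (hb : 1 - α < lam) (m x : ℝ) :
    quadCost x (optimalMap α m lam x) = (α / (lam - α)) ^ 2 * ((x - m)⁺) ^ 2
      + ((1 - α) / (lam - (1 - α))) ^ 2 * ((x - m)⁻) ^ 2 := by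
  have h1 : lam - α ≠ 0 := by linarith
  have h2 : lam - (1 - α) ≠ 0 := by linarith
  rw [quadCost, sq_abs, optimalMap]
  rcases le_total 0 (x - m) with h | h
  · rw [posPart_of_nonneg h, negPart_of_nonneg h]
    field_simp; ring
  · rw [posPart_of_nonpos h, negPart_of_nonpos h]
    field_simp; ring

lemma expectileLoss_optimalMap {α lam : ℝ} (hα0 : 0 < α) (ha : α < lam) (hb : 1 - α < lam)
    (m x : ℝ) :
    expectileLoss α (optimalMap α m lam x - m)
      = α * (lam / (lam - α)) ^ 2 * ((x - m)⁺) ^ 2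
      + (1 - α) * (lam / (lam - (1 - α))) ^ 2 * ((x - m)⁻) ^ 2 := by
  have h1 : 0 < lam - α := by linarith
  have h2 : 0 < lam - (1 - α) := by linarith
  have hlam : 0 < lam := hα0.trans ha
  rcases le_total 0 (x - m) with h | h
  · have e : optimalMap α m lam x - m = lam / (lam - α) * (x - m) := by
      rw [optimalMap, posPart_of_nonneg h, negPart_of_nonneg h]; ring
    rw [e, expectileLoss_of_nonneg _ (by positivity), posPart_of_nonneg h, negPart_of_nonneg h]
    ring
  · have e : optimalMap α m lam x - m = lam / (lam - (1 - α)) * (x - m) := by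
      rw [optimalMap, posPart_of_nonpos h, negPart_of_nonpos h]; ring
    rw [e, expectileLoss_of_nonpos _ (mul_nonpos_of_nonneg_of_nonpos (by positivity) h),
      posPart_of_nonpos h, negPart_of_nonpos h]
    ring

section OptimalMap

variable {ν : Measure ℝ} [IsProbabilityMeasure ν]

lemma integrable_quadCost_optimalMap (h2 : MemLp id 2 ν) {α lam : ℝ} (ha : α < lam)
    (hb : 1 - α < lam) (m : ℝ) : Integrable (fun x => quadCost x (optimalMap α m lam x)) ν := by
  simp only [quadCost_optimalMap ha hb]
  exact integrable_posPart_negPart_comb h2 m _ _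

lemma integral_quadCost_optimalMap (h2 : MemLp id 2 ν) {α lam : ℝ} (ha : α < lam)
    (hb : 1 - α < lam) (m : ℝ) :
    ∫ x, quadCost x (optimalMap α m lam x) ∂ν = optimalCost ν α m lam := by
  simp only [quadCost_optimalMap ha hb]
  exact integral_posPart_negPart_comb h2 m _ _

lemma integrable_loss_optimalMap (h2 : MemLp id 2 ν) {α lam : ℝ} (hα0 : 0 < α) (ha : α < lam)
    (hb : 1 - α < lam) (m : ℝ) :
    Integrable (fun x => expectileLoss α (optimalMap α m lam x - m)) ν := by
  simp only [expectileLoss_optimalMap hα0 ha hb]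
  exact integrable_posPart_negPart_comb h2 m _ _

/-- Pointwise, the loss at the image is the envelope minus `lam` times the cost. The correction is
the complementary slackness defect, zero when the budget is exhausted. -/
lemma integral_loss_optimalMap (h2 : MemLp id 2 ν) {α lam : ℝ} (hα0 : 0 < α) (ha : α < lam)
    (hb : 1 - α < lam) (δ m : ℝ) :
    ∫ x, expectileLoss α (optimalMap α m lam x - m) ∂ν
      = dualObjective ν id α δ m lam - lam * (δ - optimalCost ν α m lam) := by
  have h1 : lam - α ≠ 0 := by linarith
  have h2' : lam - (1 - α) ≠ 0 := by linarith
  simp only [expectileLoss_optimalMap hα0 ha hb]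
  rw [integral_posPart_negPart_comb h2, dualObjective, optimalCost]
  simp only [id]
  have e1 : α * (lam / (lam - α)) ^ 2 = α * lam / (lam - α) + lam * (α / (lam - α)) ^ 2 := by
    field_simp; ring
  have e2 : (1 - α) * (lam / (lam - (1 - α))) ^ 2
      = (1 - α) * lam / (lam - (1 - α)) + lam * ((1 - α) / (lam - (1 - α))) ^ 2 := by
    field_simp; ring
  rw [e1, e2]
  ring

end OptimalMap

/-- Pushing in the direction of the larger slope gains `max α (1 - α)` times the cost, up to a
lower order term. -/
lemma exists_direction_loss_ge {α : ℝ} (hα0 : 0 < α) (hα1 : α < 1) :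
    ∃ σ : ℝ, σ ^ 2 = 1 ∧ ∀ k x : ℝ, 0 ≤ k →
      max α (1 - α) * (k ^ 2 - 2 * k * |x|) ≤ expectileLoss α (x + σ * k) := by
  have hβ : 0 < 1 - α := by linarith
  rcases le_total (1 - α) α with h | h
  · refine ⟨1, by norm_num, fun k x hk => ?_⟩
    rw [max_eq_left h, one_mul]
    rcases le_total 0 (x + k) with hx | hx
    · rw [expectileLoss_of_nonneg _ hx]
      refine mul_le_mul_of_nonneg_left ?_ hα0.le
      nlinarith [neg_abs_le x, sq_nonneg x]
    -- Here `k ≤ |x|`, so the claimed lower bound is nonpositive.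
    · refine le_trans ?_ (expectileLoss_nonneg hα0 hα1 _)
      refine mul_nonpos_of_nonneg_of_nonpos hα0.le ?_
      nlinarith [neg_abs_le x]
  · refine ⟨-1, by norm_num, fun k x hk => ?_⟩
    rw [max_eq_right h]
    rcases le_total (x + -1 * k) 0 with hx | hx
    · rw [expectileLoss_of_nonpos _ hx]
      refine mul_le_mul_of_nonneg_left ?_ hβ.le
      nlinarith [le_abs_self x, sq_nonneg x]
    · refine le_trans ?_ (expectileLoss_nonneg hα0 hα1 _)
      refine mul_nonpos_of_nonneg_of_nonpos hβ.le ?_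
      nlinarith [le_abs_self x]

/-- If the optimal map leaves a slack in the budget, spending it on a small mass moved far away
yields the dual value up to `(lam - max α (1 - α))` times the slack. -/
lemma sub_slack_le_penalizedSup {ν : ProbabilityMeasure ℝ} (h2 : MemLp id 2 (ν : Measure ℝ))
    {α δ lam : ℝ} (hα0 : 0 < α) (hα1 : α < 1) (ha : α < lam) (hb : 1 - α < lam) (m : ℝ)
    (hs : optimalCost (ν : Measure ℝ) α m lam < δ) :
    ((dualObjective (ν : Measure ℝ) id α δ m lam
      - (lam - max α (1 - α)) * (δ - optimalCost (ν : Measure ℝ) α m lam) : ℝ) : EReal)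
      ≤ penalizedSup quadCost (ballPenalty δ) (expectileLoss α) ν m := by
  obtain ⟨σ, hσ, hdir⟩ := exists_direction_loss_ge hα0 hα1
  set M := max α (1 - α) with hM
  set C := optimalCost (ν : Measure ℝ) α m lam with hC
  set s := δ - C with hsdef
  have hs0 : 0 < s := by linarith
  have hC0 : 0 ≤ C := by rw [hC, optimalCost]; positivity
  set H := dualObjective (ν : Measure ℝ) id α δ m lam - lam * s with hH
  have habs : Integrable (fun x => |x - m|) (ν : Measure ℝ) :=
    ((h2.sub (memLp_const m)).integrable one_le_two).abs
  set D := ∫ x, |x - m| ∂(ν : Measure ℝ) with hD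
  -- A mass `s / k²` moved by `k` costs exactly `s` and gains `M * s` up to `O(1/k)`; `H` is the
  -- loss of the optimal map alone.
  have hk : ∀ k : ℝ, 0 < k → s ≤ k ^ 2 →
      (((1 - s / k ^ 2) * H + M * s - 2 * M * s * D / k : ℝ) : EReal)
        ≤ penalizedSup quadCost (ballPenalty δ) (expectileLoss α) ν m := by
    intro k hk hsk
    have hk2 : (0 : ℝ) < k ^ 2 := by positivity
    have hq : ∀ x, quadCost x (x + σ * k) = k ^ 2 := fun x => by
      rw [quadCost, sq_abs]; linear_combination k ^ 2 * hσ
    have hSl : Integrable (fun x => expectileLoss α (x + σ * k - m)) (ν : Measure ℝ) := by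
      have := integrable_posPart_negPart_comb h2 (m - σ * k) α (1 - α)
      refine this.congr (ae_of_all _ fun x => ?_)
      have e : x - (m - σ * k) = x + σ * k - m := by ring
      simp only [e, expectileLoss]
    have hε1 : s / k ^ 2 ≤ 1 := (div_le_one hk2).2 hsk
    have hε0 : 0 ≤ s / k ^ 2 := by positivity
    have hmix := mixture_le_penalizedSup (δ := δ) hα0 hα1 m (measurable_optimalMap α m lam)
      (S := fun x => x + σ * k) (by fun_prop) hε0 hε1
      (integrable_quadCost_optimalMap h2 ha hb m) (by simp [hq])
      (integrable_loss_optimalMap h2 hα0 ha hb m) hSl (by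
        simp only [hq, integral_quadCost_optimalMap h2 ha hb, ← hC, integral_const, probReal_univ,
          one_smul]
        rw [div_mul_cancel₀ _ hk2.ne']
        nlinarith [mul_nonneg hε0 hC0])
    refine le_trans (EReal.coe_le_coe_iff.2 ?_) hmix
    rw [integral_loss_optimalMap h2 hα0 ha hb δ, ← hC, ← hsdef, ← hH]
    have hlow : M * (k ^ 2 - 2 * k * D) ≤ ∫ x, expectileLoss α (x + σ * k - m) ∂(ν : Measure ℝ) := by
      have hint : Integrable (fun x => M * (k ^ 2 - 2 * k * |x - m|)) (ν : Measure ℝ) :=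
        ((integrable_const _).sub (habs.const_mul _)).const_mul _
      have e : ∫ x, M * (k ^ 2 - 2 * k * |x - m|) ∂(ν : Measure ℝ) = M * (k ^ 2 - 2 * k * D) := by
        rw [integral_const_mul, integral_sub (integrable_const _) (habs.const_mul _),
          integral_const_mul]
        simp [hD]
      rw [← e]
      refine integral_mono hint hSl fun x => ?_
      have := hdir k (x - m) hk.le
      rwa [show x - m + σ * k = x + σ * k - m by ring] at this
    have := mul_le_mul_of_nonneg_left hlow hε0
    have e : s / k ^ 2 * (M * (k ^ 2 - 2 * k * D)) = M * s - 2 * M * s * D / k := by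
      field_simp
    linarith
  have hlim : Tendsto (fun k : ℝ => (1 - s / k ^ 2) * H + M * s - 2 * M * s * D / k) atTop
      (𝓝 ((1 - 0) * H + M * s - 0)) := by
    refine (((tendsto_const_nhds.sub ?_).mul_const H).add_const _).sub ?_
    · exact tendsto_const_nhds.div_atTop (tendsto_pow_atTop two_ne_zero)
    · exact tendsto_const_nhds.div_atTop tendsto_id
  have hval : (1 - 0) * H + M * s - 0
      = dualObjective (ν : Measure ℝ) id α δ m lam - (lam - M) * s := by rw [hH]; ring
  rw [hval] at hlim
  refine le_of_tendsto ((continuous_coe_real_ereal.tendsto _).comp hlim) ?_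
  filter_upwards [eventually_gt_atTop 0,
    (tendsto_pow_atTop (α := ℝ) two_ne_zero).eventually_ge_atTop s] with k h0 h1
  exact hk k h0 h1

/-! ### Strong duality -/

lemma continuousOn_optimalCost (ν : Measure ℝ) (α m : ℝ) :
    ContinuousOn (optimalCost ν α m) (Set.Ioi (max α (1 - α))) := by
  have h1 : ∀ lam ∈ Set.Ioi (max α (1 - α)), lam - α ≠ 0 := fun lam h => by
    have := (max_lt_iff.1 (Set.mem_Ioi.1 h)).1; linarith
  have h2 : ∀ lam ∈ Set.Ioi (max α (1 - α)), lam - (1 - α) ≠ 0 := fun lam h => by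
    have := (max_lt_iff.1 (Set.mem_Ioi.1 h)).2; linarith
  unfold optimalCost
  fun_prop (disch := assumption)

lemma tendsto_optimalCost_atTop (ν : Measure ℝ) (α m : ℝ) :
    Tendsto (optimalCost ν α m) atTop (𝓝 0) := by
  have h : ∀ c : ℝ, Tendsto (fun lam : ℝ => (c / (lam - c)) ^ 2) atTop (𝓝 0) := fun c => by
    have := (tendsto_const_nhds (x := c)).div_atTop
      (tendsto_atTop_add_const_right atTop (-c) tendsto_id)
    simpa [sub_eq_add_neg] using this.pow 2
  simpa [funext fun lam => optimalCost.eq_1 ν α m lam] using ((h α).mul_const (∫ x, ((x - m)⁺) ^ 2 ∂ν)).add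
    ((h (1 - α)).mul_const (∫ x, ((x - m)⁻) ^ 2 ∂ν))

/-- Strong duality over the Wasserstein ball. -/
theorem penalizedSup_eq_iInf_dualObjective {ν : ProbabilityMeasure ℝ}
    (h2 : MemLp id 2 (ν : Measure ℝ)) {α δ : ℝ} (hα0 : 0 < α) (hα1 : α < 1) (hδ : 0 < δ) (m : ℝ) :
    penalizedSup quadCost (ballPenalty δ) (expectileLoss α) ν m
      = ⨅ lam ∈ Set.Ioi (max α (1 - α)),
          ((dualObjective (ν : Measure ℝ) id α δ m lam : ℝ) : EReal) := by
  set M := max α (1 - α) with hM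
  refine le_antisymm (le_iInf₂ fun lam hlam => ?_) ?_
  · obtain ⟨ha, hb⟩ := max_lt_iff.1 (Set.mem_Ioi.1 hlam)
    exact penalizedSup_le_dualObjective h2 hα0 hα1 hδ ha hb m
  by_cases hex : ∃ lam ∈ Set.Ioi M, optimalCost (ν : Measure ℝ) α m lam = δ
  · obtain ⟨lam, hlam, hc⟩ := hex
    obtain ⟨ha, hb⟩ := max_lt_iff.1 (Set.mem_Ioi.1 hlam)
    refine (iInf₂_le lam hlam).trans ?_
    have hT := integrable_quadCost_optimalMap h2 ha hb m
    have hl := integrable_loss_optimalMap h2 hα0 ha hb m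
    -- With `ε = 0` the mixture is the optimal map alone.
    have := mixture_le_penalizedSup (δ := δ) hα0 hα1 m (measurable_optimalMap α m lam)
      (measurable_optimalMap α m lam) le_rfl zero_le_one hT hT hl hl
      (by simp [integral_quadCost_optimalMap h2 ha hb, hc])
    simpa [integral_loss_optimalMap h2 hα0 ha hb δ, hc] using this
  · have hlt : ∀ lam ∈ Set.Ioi M, optimalCost (ν : Measure ℝ) α m lam < δ := by
      intro lam hlam
      by_contra! hge
      -- The cost drops below `δ` for large multipliers, so a value `≥ δ` would force the value `δ`
      -- in between.
      obtain ⟨lam', hlt', hlam'⟩ := (((tendsto_optimalCost_atTop (ν : Measure ℝ) α m).eventually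
        (eventually_lt_nhds hδ)).and (eventually_gt_atTop M)).exists
      obtain ⟨l, hl, he⟩ := isPreconnected_Ioi.intermediate_value hlam' hlam
        (continuousOn_optimalCost (ν : Measure ℝ) α m) ⟨hlt'.le, hge⟩
      exact hex ⟨l, hl, he⟩
    have hstep : ∀ lam ∈ Set.Ioi M,
        (⨅ lam ∈ Set.Ioi M, ((dualObjective (ν : Measure ℝ) id α δ m lam : ℝ) : EReal))
          ≤ penalizedSup quadCost (ballPenalty δ) (expectileLoss α) ν m
            + (((lam - M) * δ : ℝ) : EReal) := by
      intro lam hlam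
      obtain ⟨ha, hb⟩ := max_lt_iff.1 (Set.mem_Ioi.1 hlam)
      have hC0 : 0 ≤ optimalCost (ν : Measure ℝ) α m lam := by rw [optimalCost]; positivity
      refine (iInf₂_le lam hlam).trans (le_trans ?_
        (add_le_add_left (sub_slack_le_penalizedSup h2 hα0 hα1 ha hb m (hlt lam hlam)) _))
      rw [← EReal.coe_add, EReal.coe_le_coe_iff]
      nlinarith [mul_nonneg (sub_nonneg.2 (le_of_lt hlam)) hC0]
    have hlim : Tendsto (fun lam : ℝ => penalizedSup quadCost (ballPenalty δ) (expectileLoss α) ν m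
        + (((lam - M) * δ : ℝ) : EReal)) (𝓝[>] M)
        (𝓝 (penalizedSup quadCost (ballPenalty δ) (expectileLoss α) ν m + ((0 : ℝ) : EReal))) := by
      have h0 : Tendsto (fun lam : ℝ => (lam - M) * δ) (𝓝[>] M) (𝓝 0) :=
        tendsto_nhdsWithin_of_tendsto_nhds
          ((by fun_prop : Continuous fun lam : ℝ => (lam - M) * δ).tendsto' M 0 (by simp))
      -- Addition is continuous here because the second summand is finite, whatever the supremum is.
      have hadd : ContinuousAt (fun p : EReal × EReal => p.1 + p.2)
          (penalizedSup quadCost (ballPenalty δ) (expectileLoss α) ν m, ((0 : ℝ) : EReal)) :=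
        EReal.continuousAt_add (Or.inr (EReal.coe_ne_bot 0)) (Or.inr (EReal.coe_ne_top 0))
      exact hadd.tendsto.comp
        (tendsto_const_nhds.prodMk_nhds ((continuous_coe_real_ereal.tendsto 0).comp h0))
    rw [EReal.coe_zero, add_zero] at hlim
    exact ge_of_tendsto hlim (eventually_nhdsWithin_of_forall hstep)

lemma dualObjective_map {Ω : Type*} [MeasurableSpace Ω] {P : Measure Ω} {X : Ω → ℝ}
    (hX : AEMeasurable X P) (α δ m lam : ℝ) :
    dualObjective (P.map X) id α δ m lam = dualObjective P X α δ m lam := by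
  unfold dualObjective
  rw [integral_map hX (Continuous.aestronglyMeasurable (by simp only [id]; fun_prop)),
    integral_map hX (Continuous.aestronglyMeasurable (by simp only [id]; fun_prop))]
  rfl

end RobustExpectile

end

theorem proposition3p2 {Ω : Type*} [MeasurableSpace Ω] (P : ProbabilityMeasure Ω)
    (X : Ω → ℝ) (hX : MemLp X 2 (P : Measure Ω))
    (α : ℝ) (hα0 : 0 < α) (hα1 : α < 1) (δ₂ : ℝ) (hδ₂ : 0 < δ₂) :
    RobustExpectile.robustExpectile α (RobustExpectile.ballPenalty δ₂)
        (P.map hX.1.aemeasurable)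
      = RobustExpectile.argmin (fun m : ℝ =>
          ⨅ lam ∈ Set.Ioi (max α (1 - α)),
            ((RobustExpectile.dualObjective (P : Measure Ω) X α δ₂ m lam : ℝ) : EReal)) := by
  have h2 : MemLp id 2 ((P.map hX.1.aemeasurable : ProbabilityMeasure ℝ) : Measure ℝ) :=
    (memLp_map_measure_iff aestronglyMeasurable_id hX.1.aemeasurable).2 hX
  unfold RobustExpectile.robustExpectile
  congr 1
  funext m
  rw [RobustExpectile.penalizedSup_eq_iInf_dualObjective h2 hα0 hα1 hδ₂ m]
  simp only [ProbabilityMeasure.toMeasure_map, RobustExpectile.dualObjective_map hX.1.aemeasurable]
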